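/- Let $\mathfrak g$ be a finite-dimensional simple complex Lie algebra, let $(\cdot,\cdot)$ be the multiple of its Killing form normalized by $(\theta,\theta)=2$, where $\theta$ is the highest root, and let $\widehat{\mathfrak g}=\mathfrak g\otimes\mathbb C[t,t^{-1}]\oplus\mathbb CK$ be the affine Kac–Moody algebra, with $K$ central and $[x\otimes t^i,y\otimes t^j]=[x,y]\otimes t^{i+j}+i\,\delta_{i+j,0}\,(x,y)K$. Let $k\in\mathbb Z_{\ge0}$ and let $H$ be an integrable irreducible highest weight $\widehat{\mathfrak g}$-module of level $k$. Let $V_k(\mathfrak g)=L_0$ be the irreducible vacuum module of level $k$ with vacuum vector $|0\rangle$, graded so that $|a_1\otimes t^{-s_1}\cdots a_N\otimes t^{-s_N}|0\rangle|=s_1+\dots+s_N$. It is a vertex operator algebra and $H$ is a module over it; the fields on $H$ are, for $a_i\in\mathfrak g$ and $s_i>0$, $$Y(a_1\otimes t^{-s_1}\cdots a_N\otimes t^{-s_N}|0\rangle,z)=\frac{1}{(s_1-1)!\cdots(s_N-1)!}\,{:}\,\partial^{s_1-1}a_1(z)\cdots\partial^{s_N-1}a_N(z)\,{:},\qquad a(z)=\sum_{m\in\mathbb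 Z}(a\otimes t^m)z^{-m-1},$$ where the normally ordered product is nested from the right and the nonnegative powers of $z$ in the left factor act last, the negative ones first. Let $n\ge1$ and $u=(u_1,\dots,u_n)\in(\mathbb{CP}^1\setminus\{0\})^n$ be points, not necessarily distinct, with $u_1=\infty$, and put $\infty^{-1}=0$. Let $O_u(H)\subset H$ be the linear span of the vectors $$\operatorname{Res}_z\Bigl(z^{-1-M+|A|}\prod_{j=2}^n(z^{-1}-u_j^{-1})^{|A|}\,Y(A,z)v\Bigr),\qquad M>0,\ v\in H,\ A\in V_k(\mathfrak g)\text{ homogeneous},$$ where $\operatorname{Res}_z$ is the coefficient of $z^{-1}$, and let $A_u(H)=H/O_u(H)$. Then $$O_u(H)=\Bigl(\mathfrak g\otimes\prod_{j=1}^n(t^{-1}-u_j^{-1})\,\mathbb C[t^{-1}]\Bigr)H .$$ Hence $A_u(H)$ is, as a quotient of $H$, the space of coinvariants of $H$ with respect to the Lie subalgebra $\mathfrak g\otimes\prod_{j=1}^n(t^{-1}-u_j^{-1})\mathbb C[t^{-1}]$ of $\widehat{\mathfrak g}$. The equality also holds when $O_u(H)$ is computed from any vertex algebra structure on $V_k(\mathfrak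 g)$ with vacuum $|0\rangle$ and any module structure on $H$ over it such that, on $V_k(\mathfrak g)$ and on $H$, the field of $a\otimes t^{-1}|0\rangle$ is $a(z)$ for all $a\in\mathfrak g$. -/

import Mathlib

open scoped TensorProduct

namespace GaberdielGoddard

noncomputable section

universe w

/-! ### The affine Kac–Moody algebra `𝔤 ⊗ ℂ[t, t⁻¹] ⊕ ℂ K` -/

/-- A symmetric invariant bilinear form on a complex Lie algebra. -/
structure InvariantForm (𝔤 : Type w) [LieRing 𝔤] [LieAlgebra ℂ 𝔤] where
  form : LinearMap.BilinForm ℂ 𝔤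
  invariant : form.lieInvariant 𝔤
  symm : form.IsSymm

section Affine

variable {𝔤 : Type w} [LieRing 𝔤] [LieAlgebra ℂ 𝔤] (B : InvariantForm 𝔤)

/-- The cocycle `(x ⊗ tⁱ, y ⊗ tʲ) ↦ i δ_{i+j,0} (x, y)`. Mathlib's cocycle of a form `Φ` is
`(x ⊗ tⁱ, y ⊗ tʲ) ↦ j δ_{i+j,0} Φ(x, y)`, hence the sign. -/
abbrev affineCocycle :
    LieModule.Cohomology.twoCocycle ℂ (LieAlgebra.loopAlgebra ℂ ℤ 𝔤)
      (TrivialLieModule ℂ (LieAlgebra.loopAlgebra ℂ ℤ 𝔤) ℂ) :=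
  LieAlgebra.LoopAlgebra.twoCocycleOfBilinear ℂ ℤ 𝔤 (-B.form)
    (fun x y z => by simp [B.invariant x y z]) ⟨fun x y => by simp [B.symm.eq x y]⟩

/-- The affine Lie algebra `𝔤 ⊗ ℂ[t, t⁻¹] ⊕ ℂ K` attached to an invariant form. -/
abbrev AffineLie : Type w := LieAlgebra.ofTwoCocycle (affineCocycle B)

/-- The element `x ⊗ f(t)` of the affine Lie algebra. -/
def loopElt (f : LaurentPolynomial ℂ) (x : 𝔤) : AffineLie B :=
  LieAlgebra.ofProd (affineCocycle B) (f ⊗ₜ[ℂ] x, 0)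

/-- The element `x ⊗ tᵐ`. -/
def tensorT (x : 𝔤) (m : ℤ) : AffineLie B := loopElt B (LaurentPolynomial.T m) x

/-- The central element `K`. -/
def centralK : AffineLie B :=
  LieAlgebra.ofProd (affineCocycle B) (0, (TrivialLieModule.equiv ℂ _ ℂ).symm 1)

theorem residuePairing_T (Φ : LinearMap.BilinForm ℂ 𝔤) (x y : 𝔤) (i j : ℤ) :
    LieAlgebra.LoopAlgebra.residuePairing ℂ ℤ 𝔤 Φ
      ((LaurentPolynomial.T i : LaurentPolynomial ℂ) ⊗ₜ[ℂ] x)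
      ((LaurentPolynomial.T j : LaurentPolynomial ℂ) ⊗ₜ[ℂ] y) =
      if i + j = 0 then (j : ℂ) * Φ x y else 0 := by
  have hT : ∀ (m : ℤ) (z : 𝔤), LieAlgebra.LoopAlgebra.toFinsupp ℂ ℤ 𝔤
      ((LaurentPolynomial.T m : LaurentPolynomial ℂ) ⊗ₜ[ℂ] z) = Finsupp.single m z :=
    fun m z => LieAlgebra.LoopAlgebra.toFinsupp_single_tmul ℂ ℤ 𝔤 m z
  rw [LieAlgebra.LoopAlgebra.residuePairing_apply_apply, hT, hT, Finsupp.sum_single_index (by simp)]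
  by_cases h : i + j = 0
  · have : i = -j := by omega
    simp [this]
  · have : i ≠ -j := by omega
    simp [h, this]

theorem lie_loopElt (f g : LaurentPolynomial ℂ) (x y : 𝔤) :
    ⁅loopElt B f x, loopElt B g y⁆ = loopElt B (f * g) ⁅x, y⁆ +
      (-LieAlgebra.LoopAlgebra.residuePairing ℂ ℤ 𝔤 B.form (f ⊗ₜ[ℂ] x) (g ⊗ₜ[ℂ] y)) •
        centralK B := by
  rw [LieAlgebra.bracket_ofTwoCocycle]
  apply (LieAlgebra.ofProd (affineCocycle B)).symm.injective
  rw [LieAlgebra.of_symm_add, LieAlgebra.of_symm_smul]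
  refine Prod.ext ?_ ?_
  · simp [loopElt, centralK]
  · have h : LieAlgebra.LoopAlgebra.residuePairing ℂ ℤ 𝔤 (-B.form) (f ⊗ₜ[ℂ] x) (g ⊗ₜ[ℂ] y) =
        -LieAlgebra.LoopAlgebra.residuePairing ℂ ℤ 𝔤 B.form (f ⊗ₜ[ℂ] x) (g ⊗ₜ[ℂ] y) := by
      simp [Finsupp.sum]
    have h' : (affineCocycle B).1.1 (f ⊗ₜ[ℂ] x)
        (g ⊗ₜ[ℂ] y) = (TrivialLieModule.equiv ℂ _ ℂ).symm
          (LieAlgebra.LoopAlgebra.residuePairing ℂ ℤ 𝔤 (-B.form) (f ⊗ₜ[ℂ] x) (g ⊗ₜ[ℂ] y)) := rfl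
    rw [h] at h'
    simpa [loopElt, centralK, ← map_smul, -LieAlgebra.LoopAlgebra.residuePairing_apply_apply]
      using h'

/-- The defining bracket `[x ⊗ tⁱ, y ⊗ tʲ] = [x, y] ⊗ tⁱ⁺ʲ + i δ_{i+j,0} (x, y) K`. -/
theorem lie_tensorT (x y : 𝔤) (i j : ℤ) :
    ⁅tensorT B x i, tensorT B y j⁆ =
      tensorT B ⁅x, y⁆ (i + j) + (if i + j = 0 then (i : ℂ) * B.form x y else 0) • centralK B := by
  rw [tensorT, tensorT, lie_loopElt, residuePairing_T, tensorT, LaurentPolynomial.T_add]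
  congr 2
  split_ifs with h
  · have : (j : ℂ) = -i := by
      have : j = -i := by omega
      exact_mod_cast this
    rw [this]; ring
  · simp

theorem lie_centralK (X : AffineLie B) : ⁅centralK B, X⁆ = 0 := by
  rw [LieAlgebra.bracket_ofTwoCocycle]
  apply (LieAlgebra.ofProd (affineCocycle B)).symm.injective
  simp [centralK, LieModule.IsTrivial.trivial]

theorem residuePairing_aeval (Φ : LinearMap.BilinForm ℂ 𝔤) (x y : 𝔤) (p q : Polynomial ℂ) :
    LieAlgebra.LoopAlgebra.residuePairing ℂ ℤ 𝔤 Φ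
      ((Polynomial.aeval (LaurentPolynomial.T (-1) : LaurentPolynomial ℂ) p) ⊗ₜ[ℂ] x)
      ((Polynomial.aeval (LaurentPolynomial.T (-1) : LaurentPolynomial ℂ) q) ⊗ₜ[ℂ] y) = 0 := by
  induction p using Polynomial.induction_on' with
  | add p₁ p₂ h₁ h₂ => rw [map_add, TensorProduct.add_tmul, map_add, LinearMap.add_apply, h₁, h₂,
      add_zero]
  | monomial i a =>
    induction q using Polynomial.induction_on' with
    | add q₁ q₂ h₁ h₂ => rw [map_add, TensorProduct.add_tmul, map_add, h₁, h₂, add_zero]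
    | monomial j b =>
      rw [Polynomial.aeval_monomial, Polynomial.aeval_monomial, ← Algebra.smul_def,
        ← Algebra.smul_def, ← TensorProduct.smul_tmul', ← TensorProduct.smul_tmul', map_smul, map_smul,
        LinearMap.smul_apply, LaurentPolynomial.T_pow, LaurentPolynomial.T_pow, residuePairing_T]
      split_ifs with h
      · have : j = 0 := by omega
        simp [this]
      · simp

/-- The points of `ℂℙ¹ ∖ {0}` enter through `u⁻¹`, with `∞⁻¹ = 0`. -/
def invPoint (u : OnePoint ℂ) : ℂ := u.elim 0 fun z => z⁻¹

/-- The Lie subalgebra `𝔤 ⊗ ∏ⱼ (t⁻¹ - uⱼ⁻¹) ℂ[t⁻¹]`. -/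
def coinvariantSubalgebra {n : ℕ} (u : Fin n → OnePoint ℂ) : LieSubalgebra ℂ (AffineLie B) where
  toSubmodule := Submodule.span ℂ {X | ∃ (q : Polynomial ℂ) (x : 𝔤),
    X = loopElt B ((∏ j, (LaurentPolynomial.T (-1) - LaurentPolynomial.C (invPoint (u j)))) *
      Polynomial.aeval (LaurentPolynomial.T (-1)) q) x}
  lie_mem' := by
    intro X Y hX hY
    simp only [AddSubsemigroup.mem_carrier, AddSubmonoid.mem_toSubsemigroup,
      Submodule.mem_toAddSubmonoid] at hX hY ⊢
    have hP : (∏ j, (LaurentPolynomial.T (-1) - LaurentPolynomial.C (invPoint (u j))) :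
        LaurentPolynomial ℂ) = Polynomial.aeval (LaurentPolynomial.T (-1))
          (∏ j, (Polynomial.X - Polynomial.C (invPoint (u j)))) := by
      rw [map_prod]
      refine Finset.prod_congr rfl fun j _ => ?_
      rw [map_sub, Polynomial.aeval_X, Polynomial.aeval_C]
      rfl
    refine Submodule.span_induction₂ (p := fun X Y _ _ => ⁅X, Y⁆ ∈ _)
      ?_ ?_ ?_ ?_ ?_ ?_ ?_ hX hY
    · rintro _ _ ⟨q, x, rfl⟩ ⟨r, y, rfl⟩
      refine Submodule.subset_span ⟨q * ((∏ j, (Polynomial.X - Polynomial.C (invPoint (u j)))) * r),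
        ⁅x, y⁆, ?_⟩
      rw [lie_loopElt, hP, ← map_mul, ← map_mul, residuePairing_aeval, neg_zero, zero_smul, add_zero,
        ← map_mul, ← map_mul, mul_assoc]
    · intro Y _; rw [zero_lie]; exact zero_mem _
    · intro X _; rw [lie_zero]; exact zero_mem _
    · intro X Y Z _ _ _ h₁ h₂; rw [add_lie]; exact add_mem h₁ h₂
    · intro X Y Z _ _ _ h₁ h₂; rw [lie_add]; exact add_mem h₁ h₂
    · intro c X Y _ _ h; rw [smul_lie]; exact Submodule.smul_mem _ c h
    · intro c X Y _ _ h; rw [lie_smul]; exact Submodule.smul_mem _ c h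

theorem mem_of_generators (S : Submodule ℂ (AffineLie B)) (hT : ∀ x m, tensorT B x m ∈ S)
    (hK : centralK B ∈ S) (X : AffineLie B) : X ∈ S := by
  have h1 : ∀ f : LieAlgebra.loopAlgebra ℂ ℤ 𝔤, LieAlgebra.ofProd (affineCocycle B) (f, 0) ∈ S := by
    intro f
    induction f using TensorProduct.induction_on with
    | zero => exact zero_mem S
    | tmul f x =>
      induction f using LaurentPolynomial.induction_on' with
      | add p q hp hq =>
        rw [TensorProduct.add_tmul]
        simpa [← LieAlgebra.of_add] using add_mem hp hq
      | C_mul_T n a =>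
        rw [← LaurentPolynomial.smul_eq_C_mul, ← TensorProduct.smul_tmul']
        simpa [← LieAlgebra.of_smul, tensorT, loopElt] using S.smul_mem a (hT x n)
    | add p q hp hq => simpa [← LieAlgebra.of_add] using add_mem hp hq
  have h2 : X = LieAlgebra.ofProd (affineCocycle B) (((LieAlgebra.ofProd _).symm X).1, 0) +
      (TrivialLieModule.equiv ℂ _ ℂ ((LieAlgebra.ofProd _).symm X).2) • centralK B := by
    apply (LieAlgebra.ofProd (affineCocycle B)).symm.injective
    rw [LieAlgebra.of_symm_add, LieAlgebra.of_symm_smul]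
    refine Prod.ext ?_ ?_
    · simp [centralK]
    · simp [centralK, ← map_smul]
  rw [h2]
  exact add_mem (h1 _) (S.smul_mem _ hK)

/-! ### Integrable highest weight modules -/

/-- Every vector is killed by `𝔤 ⊗ tᵐ` for all large `m`. -/
def IsSmooth (M : Type*) [AddCommGroup M] [Module ℂ M] [LieRingModule (AffineLie B) M] : Prop :=
  ∀ v : M, ∃ N : ℤ, ∀ m : ℤ, N < m → ∀ x : 𝔤, ⁅tensorT B x m, v⁆ = 0

theorem isSmooth_of_isIrreducible {M : Type*} [AddCommGroup M] [Module ℂ M]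
    [LieRingModule (AffineLie B) M] [LieModule ℂ (AffineLie B) M]
    (hM : LieModule.IsIrreducible ℂ (AffineLie B) M) {l : M} (hl : l ≠ 0)
    (hpos : ∀ (x : 𝔤) (m : ℤ), 0 < m → ⁅tensorT B x m, l⁆ = 0) : IsSmooth B M := by
  let S : Submodule ℂ M :=
    { carrier := {v | ∃ N : ℤ, ∀ m : ℤ, N < m → ∀ x : 𝔤, ⁅tensorT B x m, v⁆ = 0}
      add_mem' := by
        rintro v w ⟨N, hN⟩ ⟨N', hN'⟩
        refine ⟨max N N', fun m hm x => ?_⟩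
        rw [lie_add, hN m (by omega), hN' m (by omega), add_zero]
      zero_mem' := ⟨0, fun m _ x => lie_zero _⟩
      smul_mem' := by
        rintro c v ⟨N, hN⟩
        exact ⟨N, fun m hm x => by rw [lie_smul, hN m hm, smul_zero]⟩ }
  have hS : ∀ (X : AffineLie B) (v : M), v ∈ S → ⁅X, v⁆ ∈ S := by
    intro X v hv
    let R : Submodule ℂ (AffineLie B) :=
      { carrier := {X | ⁅X, v⁆ ∈ S}
        add_mem' := by
          intro X Y hX hY
          simp only [Set.mem_ofPred_eq, add_lie] at *
          exact add_mem hX hY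
        zero_mem' := by
          simp only [Set.mem_ofPred_eq, zero_lie]
          exact zero_mem S
        smul_mem' := by
          intro c X hX
          simp only [Set.mem_ofPred_eq, smul_lie] at *
          exact S.smul_mem c hX }
    obtain ⟨N, hN⟩ := hv
    refine mem_of_generators B R (fun y i => ?_) ?_ X
    · refine ⟨max N (max (N - i) (-i)), fun m hm x => ?_⟩
      rw [leibniz_lie, hN m (by omega), lie_zero, add_zero, lie_tensorT,
        if_neg (by omega), zero_smul, add_zero, hN (m + i) (by omega)]
    · refine ⟨N, fun m hm x => ?_⟩
      rw [leibniz_lie, hN m hm, lie_zero, add_zero, ← lie_skew, lie_centralK, neg_zero, zero_lie]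
  let S' : LieSubmodule ℂ (AffineLie B) M := { S with lie_mem := fun {X v} hv => hS X v hv }
  have hlS : l ∈ S' := ⟨0, fun m hm x => hpos x m hm⟩
  have htop : S' = ⊤ := by
    rcases hM.eq_bot_or_eq_top S' with h | h
    · rw [h] at hlS
      exact absurd ((LieSubmodule.mem_bot l).mp hlS) hl
    · exact h
  intro v
  have hv : v ∈ S' := htop ▸ LieSubmodule.mem_top v
  exact hv

end Affine

section HighestWeight

variable {𝔤 : Type w} [LieRing 𝔤] [LieAlgebra ℂ 𝔤] [FiniteDimensional ℂ 𝔤]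
  [LieAlgebra.IsSimple ℂ 𝔤] {𝔥 : LieSubalgebra ℂ 𝔤} [𝔥.IsCartanSubalgebra]

/-- `θ` is the highest root with respect to the base `b`: for every root `β`, the difference
`θ - β` is a sum of simple roots. -/
def IsHighestRoot (b : (LieAlgebra.IsKilling.rootSystem 𝔥).Base) (θ : 𝔥.root) : Prop :=
  ∀ β : 𝔥.root, (LieAlgebra.IsKilling.rootSystem 𝔥).root θ -
    (LieAlgebra.IsKilling.rootSystem 𝔥).root β ∈
      AddSubmonoid.closure ((LieAlgebra.IsKilling.rootSystem 𝔥).root '' b.support)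

/-- The multiple `c κ` of the Killing form `κ` for which the form induced on `𝔥*` has
`(θ, θ) = 2`. The form induced by `κ` has `(θ, θ) = κ(t_θ, t_θ) = θ(t_θ)`, where `t_θ ∈ 𝔥`
corresponds to `θ` under `κ`, and the form induced by `c κ` has `(θ, θ) = c⁻¹ θ(t_θ)`. -/
def normalizedForm (θ : 𝔥.root) : InvariantForm 𝔤 where
  form := ((2 : ℂ)⁻¹ * (θ : LieModule.Weight ℂ 𝔥 𝔤)
    ((LieAlgebra.IsKilling.cartanEquivDual 𝔥).symm (θ : LieModule.Weight ℂ 𝔥 𝔤).toLinear)) •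
      killingForm ℂ 𝔤
  invariant := fun x y z => by
    have h := LieModule.traceForm_lieInvariant ℂ 𝔤 𝔤 x y z
    rw [LinearMap.smul_apply, LinearMap.smul_apply, LinearMap.smul_apply, LinearMap.smul_apply, h,
      smul_neg]
  symm := ⟨fun x y => by simp [LieModule.traceForm_comm ℂ 𝔤 𝔤 x y]⟩

/-- Irreducible integrable highest weight modules of level `k` over the affine Kac–Moody algebra. -/
structure IsIntegrableHighestWeight (b : (LieAlgebra.IsKilling.rootSystem 𝔥).Base) (θ : 𝔥.root)
    (k : ℕ) (M : Type*) [AddCommGroup M] [Module ℂ M]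
    [LieRingModule (AffineLie (normalizedForm θ)) M]
    [LieModule ℂ (AffineLie (normalizedForm θ)) M] : Prop where
  irreducible : LieModule.IsIrreducible ℂ (AffineLie (normalizedForm θ)) M
  level : ∀ v : M, ⁅centralK (normalizedForm θ), v⁆ = (k : ℂ) • v
  /-- There is a highest weight vector: it is killed by `𝔫 ⊗ 1` and `𝔤 ⊗ t ℂ[t]`, and it is an
  eigenvector of `𝔥 ⊗ 1`. -/
  exists_highest : ∃ l : M, l ≠ 0 ∧
    (∀ α : 𝔥.root, b.IsPos α → ∀ x ∈ LieAlgebra.rootSpace 𝔥 (α : LieModule.Weight ℂ 𝔥 𝔤),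
      ⁅tensorT (normalizedForm θ) x 0, l⁆ = 0) ∧
    (∀ (x : 𝔤) (m : ℤ), 0 < m → ⁅tensorT (normalizedForm θ) x m, l⁆ = 0) ∧
    ∃ μ : Module.Dual ℂ 𝔥, ∀ h : 𝔥, ⁅tensorT (normalizedForm θ) (h : 𝔤) 0, l⁆ = μ h • l
  /-- All real root vectors act locally nilpotently. -/
  integrable : ∀ α : 𝔥.root, ∀ x ∈ LieAlgebra.rootSpace 𝔥 (α : LieModule.Weight ℂ 𝔥 𝔤),
    ∀ (m : ℤ) (v : M), ∃ N : ℕ,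
      (LieModule.toEnd ℂ (AffineLie (normalizedForm θ)) M
        (tensorT (normalizedForm θ) x m) ^ N) v = 0

theorem IsIntegrableHighestWeight.isSmooth {b : (LieAlgebra.IsKilling.rootSystem 𝔥).Base}
    {θ : 𝔥.root} {k : ℕ} {M : Type*} [AddCommGroup M] [Module ℂ M]
    [LieRingModule (AffineLie (normalizedForm θ)) M]
    [LieModule ℂ (AffineLie (normalizedForm θ)) M] (hM : IsIntegrableHighestWeight b θ k M) :
    IsSmooth (normalizedForm θ) M := by
  obtain ⟨l, hl, -, hpos, -⟩ := hM.exists_highest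
  exact isSmooth_of_isIrreducible _ hM.irreducible hl hpos

end HighestWeight

/-! ### The vacuum module `V_k(𝔤) = L_0` -/

section Vacuum

variable {𝔤 : Type w} [LieRing 𝔤] [LieAlgebra ℂ 𝔤] (B : InvariantForm 𝔤) (k : ℕ)

/-- The largest proper left ideal of `U(𝔤̂)` containing `𝔤 ⊗ ℂ[t]` and `K - k`. -/
def vacuumIdeal : Submodule (UniversalEnvelopingAlgebra ℂ (AffineLie B))
    (UniversalEnvelopingAlgebra ℂ (AffineLie B)) :=
  sSup {J | J ≠ ⊤ ∧
    (∀ (x : 𝔤) (m : ℤ), 0 ≤ m → UniversalEnvelopingAlgebra.ι ℂ (tensorT B x m) ∈ J) ∧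
    UniversalEnvelopingAlgebra.ι ℂ (centralK B) - algebraMap ℂ _ (k : ℂ) ∈ J}

/-- The underlying space of `V_k(𝔤)`: the irreducible highest weight module `L_0` of level `k`. -/
abbrev VacuumModule : Type w :=
  UniversalEnvelopingAlgebra ℂ (AffineLie B) ⧸ vacuumIdeal B k

instance : LieRingModule (AffineLie B) (VacuumModule B k) where
  bracket X v := UniversalEnvelopingAlgebra.ι ℂ X • v
  add_lie X Y v := by
    change UniversalEnvelopingAlgebra.ι ℂ (X + Y) • v = _
    rw [map_add, add_smul]
  lie_add X v v' := smul_add _ v v'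
  leibniz_lie X Y v := by
    change UniversalEnvelopingAlgebra.ι ℂ X • UniversalEnvelopingAlgebra.ι ℂ Y • v =
      UniversalEnvelopingAlgebra.ι ℂ ⁅X, Y⁆ • v +
        UniversalEnvelopingAlgebra.ι ℂ Y • UniversalEnvelopingAlgebra.ι ℂ X • v
    let _ : LieRing (UniversalEnvelopingAlgebra ℂ (AffineLie B)) := LieRing.ofAssociativeRing
    rw [LieHom.map_lie, LieRing.of_associative_ring_bracket, sub_smul, mul_smul, mul_smul,
      sub_add_cancel]

instance : LieModule ℂ (AffineLie B) (VacuumModule B k) where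
  smul_lie c X v := by
    change UniversalEnvelopingAlgebra.ι ℂ (c • X) • v = c • UniversalEnvelopingAlgebra.ι ℂ X • v
    rw [map_smul, smul_assoc]
  lie_smul c X v := by
    change UniversalEnvelopingAlgebra.ι ℂ X • c • v = c • UniversalEnvelopingAlgebra.ι ℂ X • v
    rw [smul_comm]

/-- The vacuum vector `|0⟩ = l_0`. -/
def vacuum : VacuumModule B k :=
  Submodule.Quotient.mk (p := vacuumIdeal B k) (1 : UniversalEnvelopingAlgebra ℂ (AffineLie B))

/-- The degree `s₁ + ⋯ + s_N` of a word `(a₁, s₁) ⋯ (a_N, s_N)`. -/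
def wordDegree (W : List (𝔤 × ℕ+)) : ℕ := (W.map fun p => (p.2 : ℕ)).sum

/-- The vector `a₁ ⊗ t^{-s₁} ⋯ a_N ⊗ t^{-s_N} |0⟩`. -/
def wordState : List (𝔤 × ℕ+) → VacuumModule B k
  | [] => vacuum B k
  | p :: W => ⁅tensorT B p.1 (-(p.2 : ℤ)), wordState W⁆

/-- The component of degree `d` of the energy grading of `V_k(𝔤)`. -/
def vacuumDegree (d : ℕ) : Submodule ℂ (VacuumModule B k) :=
  Submodule.span ℂ {A | ∃ W : List (𝔤 × ℕ+), wordDegree W = d ∧ A = wordState B k W}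

end Vacuum

/-! ### Fields -/

section Fields

variable {M : Type*} [AddCommGroup M] [Module ℂ M]

theorem exists_coeff_eq_zero (F : VertexOperator ℂ M) (v : M) :
    ∃ N : ℤ, ∀ n < N, HVertexOperator.coeff F n v = 0 :=
  ⟨_, fun n hn => VertexOperator.coeff_eq_zero_of_lt_order F n v hn⟩

theorem bddBelow_support {A : Type*} [AddCommGroup A] {f : ℤ → A} (N : ℤ) (h : ∀ n < N, f n = 0) :
    BddBelow (Function.support f) :=
  ⟨N, fun n hn => not_lt.mp fun hlt => hn (h n hlt)⟩

/-- The identity field `Y(|0⟩, z) = Id`. -/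
def idField : VertexOperator ℂ M :=
  VertexOperator.of_coeff (fun n => if n = 0 then 1 else 0) fun v =>
    bddBelow_support 0 fun n hn => by simp [hn.ne]

/-- The derivative `∂F(z)`. -/
def derivField (F : VertexOperator ℂ M) : VertexOperator ℂ M :=
  VertexOperator.of_coeff (fun n => ((n + 1 : ℤ) : ℂ) • HVertexOperator.coeff F (n + 1)) fun v => by
    obtain ⟨N, hN⟩ := exists_coeff_eq_zero F v
    refine bddBelow_support (N - 1) fun n hn => ?_
    rw [LinearMap.smul_apply, hN _ (by omega), smul_zero]

/-- The contribution of the coefficient of `zⁱ` in `F` to the coefficient of `zⁿ` in the normally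
ordered product `:F(z)G(z):`. The nonnegative powers of `z` in `F` act after `G`, the negative powers act
before `G`. -/
def normalTerm (F G : VertexOperator ℂ M) (n i : ℤ) : Module.End ℂ M :=
  if 0 ≤ i then HVertexOperator.coeff F i ∘ₗ HVertexOperator.coeff G (n - i)
  else HVertexOperator.coeff G (n - i) ∘ₗ HVertexOperator.coeff F i

theorem normalTerm_finite (F G : VertexOperator ℂ M) (n : ℤ) (v : M) :
    (Function.support fun i => normalTerm F G n i v).Finite := by
  obtain ⟨N, hN⟩ := exists_coeff_eq_zero F v
  obtain ⟨N', hN'⟩ := exists_coeff_eq_zero G v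
  refine (Set.finite_Icc N (n - N')).union (Set.finite_Icc N (-1)) |>.union
    (Set.finite_Icc 0 (n - N')) |>.subset fun i hi => ?_
  by_contra hcon
  simp only [Set.mem_union, Set.mem_Icc, not_or, not_and, not_le] at hcon
  refine hi ?_
  simp only [normalTerm]
  split_ifs with h0
  · rw [LinearMap.comp_apply, hN' _ (by omega), map_zero]
  · rw [LinearMap.comp_apply, hN _ (by omega), map_zero]

/-- The normally ordered product `:F(z)G(z):`. -/
def normalOrder (F G : VertexOperator ℂ M) : VertexOperator ℂ M :=
  VertexOperator.of_coeff
    (fun n =>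
      { toFun := fun v => ∑ᶠ i : ℤ, normalTerm F G n i v
        map_add' := fun v v' => by
          simp only [map_add]
          exact finsum_add_distrib (normalTerm_finite F G n v) (normalTerm_finite F G n v')
        map_smul' := fun c v => by
          simp only [map_smul, RingHom.id_apply]
          exact (smul_finsum' c (normalTerm_finite F G n v)).symm })
    fun v => by
      obtain ⟨N, hN⟩ := exists_coeff_eq_zero F v
      obtain ⟨N', hN'⟩ := exists_coeff_eq_zero G v
      choose P hP using fun i : ℤ => exists_coeff_eq_zero G (HVertexOperator.coeff F i v)
      obtain ⟨Q, hQ⟩ : ∃ Q : ℤ, ∀ i ∈ Finset.Icc N (-1), Q ≤ P i + i := by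
        obtain ⟨Q, hQ⟩ := ((Finset.Icc N (-1)).image fun i => P i + i).bddBelow
        exact ⟨Q, fun i hi => hQ (Finset.mem_coe.mpr (Finset.mem_image_of_mem _ hi))⟩
      refine bddBelow_support (min N' Q) fun n hn => ?_
      change ∑ᶠ i : ℤ, normalTerm F G n i v = 0
      refine finsum_eq_zero_of_forall_eq_zero fun i => ?_
      simp only [normalTerm]
      split_ifs with h0
      · rw [LinearMap.comp_apply, hN' _ (by omega), map_zero]
      · rw [LinearMap.comp_apply]
        by_cases hi : i < N
        · rw [hN _ hi, map_zero]
        · have := hQ i (Finset.mem_Icc.mpr ⟨by omega, by omega⟩)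
          exact hP i _ (by omega)

/-- The residue `Res (p(z) F(z))`, i.e. the coefficient of `z⁻¹`. -/
def residue (p : LaurentPolynomial ℂ) (F : VertexOperator ℂ M) : Module.End ℂ M :=
  p.coeff.sum fun i c => c • HVertexOperator.coeff F (-1 - i)

/-- For a field `F = Y(A, z)` with `|A| = d`, the operator
`Res (z^{-1-N+d} ∏_{j ≥ 2} (z⁻¹ - uⱼ⁻¹)^d F(z))`. The points are numbered from `0`, and `u 0 = ∞`
does not enter the product. -/
def ggOperator {n : ℕ} (u : Fin (n + 1) → OnePoint ℂ) (N : ℤ) (d : ℕ) (F : VertexOperator ℂ M) :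
    Module.End ℂ M :=
  residue (LaurentPolynomial.T (-1 - N + d) * ∏ j : Fin n,
    (LaurentPolynomial.T (-1) - LaurentPolynomial.C (invPoint (u j.succ))) ^ d) F

/-- The Gaberdiel–Goddard subspace computed from a set `Φ` of fields, each with its degree. -/
def ggSubspace {n : ℕ} (u : Fin (n + 1) → OnePoint ℂ) (Φ : Set (ℕ × VertexOperator ℂ M)) :
    Submodule ℂ M :=
  Submodule.span ℂ {w | ∃ P ∈ Φ, ∃ N : ℤ, 0 < N ∧ ∃ v : M, w = ggOperator u N P.1 P.2 v}

end Fields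

/-! ### `V_k(𝔤)` and its fields on a module -/

section VertexAlgebra

variable {𝔤 : Type w} [LieRing 𝔤] [LieAlgebra ℂ 𝔤] (B : InvariantForm 𝔤)
  {M : Type*} [AddCommGroup M] [Module ℂ M] [LieRingModule (AffineLie B) M]
  [LieModule ℂ (AffineLie B) M]

/-- The current `a(z) = ∑ₘ (a ⊗ tᵐ) z^{-m-1}` on a smooth module. -/
def current (hM : IsSmooth B M) (a : 𝔤) : VertexOperator ℂ M :=
  VertexOperator.of_coeff
    (fun n => LieModule.toEnd ℂ (AffineLie B) M (tensorT B a (-n - 1))) fun v => by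
      obtain ⟨N, hN⟩ := hM v
      exact bddBelow_support (-N - 1) fun n hn => hN _ (by omega) a

/-- The field `Y(a₁ ⊗ t^{-s₁} ⋯ a_N ⊗ t^{-s_N} |0⟩, z)`, namely
`1 / ((s₁ - 1)! ⋯ (s_N - 1)!) :∂^{s₁-1}a₁(z) (:∂^{s₂-1}a₂(z) ⋯ :)`. -/
def wordField (hM : IsSmooth B M) : List (𝔤 × ℕ+) → VertexOperator ℂ M
  | [] => idField
  | p :: W => normalOrder
      ((((p.2 : ℕ) - 1).factorial : ℂ)⁻¹ • (derivField^[(p.2 : ℕ) - 1] (current B hM p.1)))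
      (wordField hM W)

/-- The graph of the linear map `A ↦ Y_M(A, z)` on the component of degree `d` of `V_k(𝔤)`. -/
def fieldGraph (k : ℕ) (hM : IsSmooth B M) (d : ℕ) :
    Submodule ℂ (VacuumModule B k × VertexOperator ℂ M) :=
  Submodule.span ℂ {P | ∃ W : List (𝔤 × ℕ+), wordDegree W = d ∧
    P = (wordState B k W, wordField B hM W)}

/-- The fields `Y_M(A, z)` of the homogeneous vectors `A ∈ V_k(𝔤)`, with the degree of `A`. -/
def affineFields (k : ℕ) (hM : IsSmooth B M) : Set (ℕ × VertexOperator ℂ M) :=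
  {P | ∃ A : VacuumModule B k, (A, P.2) ∈ fieldGraph B k hM P.1}

/-- The Gaberdiel–Goddard subspace `O_u(M)` of a `V_k(𝔤)`-module. -/
def gaberdielGoddard (k : ℕ) (hM : IsSmooth B M) {n : ℕ} (u : Fin (n + 1) → OnePoint ℂ) :
    Submodule ℂ M :=
  ggSubspace u (affineFields B k hM)

/-- The Gaberdiel–Goddard space `A_u(M) = M / O_u(M)`. -/
abbrev GGSpace (k : ℕ) (hM : IsSmooth B M) {n : ℕ} (u : Fin (n + 1) → OnePoint ℂ) : Type _ :=
  M ⧸ gaberdielGoddard B k hM u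

/-- The subspace `𝔞 M` spanned by the vectors `X v`, `X ∈ 𝔞`, `v ∈ M`. -/
def actionSpan (𝔞 : LieSubalgebra ℂ (AffineLie B)) (M : Type*) [AddCommGroup M] [Module ℂ M]
    [LieRingModule (AffineLie B) M] : Submodule ℂ M :=
  Submodule.span ℂ {w | ∃ X ∈ 𝔞, ∃ v : M, w = ⁅X, v⁆}

/-- The space of coinvariants `M / 𝔞 M`. -/
abbrev Coinvariants (𝔞 : LieSubalgebra ℂ (AffineLie B)) (M : Type*) [AddCommGroup M] [Module ℂ M]
    [LieRingModule (AffineLie B) M] : Type _ :=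
  M ⧸ actionSpan B 𝔞 M

end VertexAlgebra

section Axioms

variable {V : Type*} [AddCommGroup V] [Module ℂ V] {M : Type*} [AddCommGroup M] [Module ℂ M]

open scoped VertexOperator in
/-- The Borcherds identity for `A, B ∈ V` and a vector of `M`, in the indexing
`Y(A, z) = ∑ₙ Aₙ z^{-n-1}`. All sums are finite. -/
def BorcherdsIdentity (Y : V →ₗ[ℂ] VertexOperator ℂ V) (YM : V →ₗ[ℂ] VertexOperator ℂ M) : Prop :=
  ∀ (A B : V) (v : M) (p q r : ℤ),
    ∑ᶠ j : ℕ, ((Ring.choose p j : ℤ) : ℂ) • ((YM (((Y A)[[r + j]]) B))[[p + q - j]]) v =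
    ∑ᶠ j : ℕ, ((-1 : ℂ) ^ j * ((Ring.choose r j : ℤ) : ℂ)) •
      (((YM A)[[p + r - j]]) (((YM B)[[q + j]]) v) -
        (-1 : ℂ) ^ r • ((YM B)[[q + r - j]]) (((YM A)[[p + j]]) v))

open scoped VertexOperator in
/-- A vertex algebra structure on `V` with vacuum vector `vac`. -/
structure VertexAlgebraStructure (V : Type*) [AddCommGroup V] [Module ℂ V] (vac : V) where
  Y : V →ₗ[ℂ] VertexOperator ℂ V
  Y_vac : Y vac = idField
  creation : ∀ A : V, ∀ n : ℤ, 0 ≤ n → ((Y A)[[n]]) vac = 0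
  creation_neg_one : ∀ A : V, ((Y A)[[-1]]) vac = A
  borcherds : BorcherdsIdentity Y Y

/-- A module structure on `M` over a vertex algebra. -/
structure VertexModuleStructure {vac : V} (𝒱 : VertexAlgebraStructure V vac)
    (M : Type*) [AddCommGroup M] [Module ℂ M] where
  Y : V →ₗ[ℂ] VertexOperator ℂ M
  Y_vac : Y vac = idField
  borcherds : BorcherdsIdentity 𝒱.Y Y

variable {𝔤 : Type w} [LieRing 𝔤] [LieAlgebra ℂ 𝔤] (B : InvariantForm 𝔤) (k : ℕ)

open scoped VertexOperator in
/-- The fields `Y(a ⊗ t⁻¹ |0⟩, z)` are the currents `∑ₘ (a ⊗ tᵐ) z^{-m-1}` on `M`. -/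
def HasCurrents (M : Type*) [AddCommGroup M] [Module ℂ M] [LieRingModule (AffineLie B) M]
    (Y : VacuumModule B k →ₗ[ℂ] VertexOperator ℂ M) : Prop :=
  ∀ (a : 𝔤) (m : ℤ) (v : M),
    ((Y ⁅tensorT B a (-1), vacuum B k⁆)[[m]]) v = ⁅tensorT B a m, v⁆

/-- The fields `Y(A, z)` of the homogeneous vectors `A ∈ V_k(𝔤)`, with the degree of `A`, for a
given state-field map on `V_k(𝔤)`. -/
def homogeneousFields (Y : VacuumModule B k →ₗ[ℂ] VertexOperator ℂ M) :
    Set (ℕ × VertexOperator ℂ M) :=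
  {P | ∃ A ∈ vacuumDegree B k P.1, P.2 = Y A}

end Axioms

end

end GaberdielGoddard

/-!
Put `x = t⁻¹`, `y = z⁻¹`, `r(x) = ∏_{j ≥ 2} (x - uⱼ⁻¹)`, so that the subalgebra is
`𝔞 = 𝔤 ⊗ x r(x) ℂ[x]`, and a generator of `O_u(H)` is, for `|A| = d` and some `m ≥ 0`,
`Res (yᵐ z⁻² (z r(y))ᵈ Y(A, z)) v`.

For `A = a ⊗ t⁻¹ |0⟩` the generator is `(a ⊗ x r(x) xᵐ) v`, and these vectors span `𝔞 H`.

For the other inclusion, induct on the length of a word `A = (a ⊗ t⁻ˢ) A'`, with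
`Y(A, z) = :∂ˢ⁻¹a(z) Y(A', z): / (s - 1)!`. A mode `a ⊗ tᵐ` with `m ≥ 0` acts before `Y(A', z)`,
and the remaining residue is of the same shape for `A'` (`residue_normalOrder_mem`). The modes acting
after `Y(A', z)` have the generating function `xˢ / (1 - z x)ˢ`, where `xᵐ` stands for `a ⊗ t⁻ᵐ`.
The factor `(z r(y))ˢ` turns it into the `s`-th power of `x r(y) / (y - x)`, and modulo the ideal
`x r(x) ℂ[x]` this is the polynomial `x (r(y) - r(x)) / (y - x)` in `x` and `y`. What is left are
vectors `(a ⊗ h(x)) w` with `w` a residue for `A'`, hence with `w ∈ 𝔞 H`; they lie in `𝔞 H` because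
`𝔞` is an ideal of `𝔤 ⊗ ℂ[x]`. The division by `y - x` is carried out in `expansion_mem`, by induction
on `s`, with truncated series.

The argument concerns the fields of words, on any smooth module. In an arbitrary vertex algebra
structure with the same currents the Borcherds identity forces the field of a word to be the same
normally ordered product (`field_wordState`), so that the two sets of fields coincide.
-/

namespace GaberdielGoddard

open Polynomial Filter
open LaurentPolynomial (T)

/-! ### Expansions of `xˢ / (1 - z x)ˢ` and reduction modulo an ideal -/

section Expansion

variable {V : Type*} [AddCommGroup V] [Module ℂ V]

/-- The substitution `x ↦ z⁻¹` from polynomials to Laurent polynomials. -/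
noncomputable abbrev invEval : ℂ[X] →ₐ[ℂ] LaurentPolynomial ℂ :=
  aeval (T (-1) : LaurentPolynomial ℂ)

/-- The truncation at order `z ^ J` of `xˢ / (1 - z x)ˢ = ∑ₘ (s + m - 1 choose m) xᵐ⁺ˢ zᵐ`, acting
on the two arguments of a bilinear map: polynomials in `x` multiply the first argument and Laurent
polynomials in `z` the second. -/
noncomputable def expansion (Ψ : ℂ[X] →ₗ[ℂ] LaurentPolynomial ℂ →ₗ[ℂ] V) (s J : ℕ) :
    ℂ[X] →ₗ[ℂ] LaurentPolynomial ℂ →ₗ[ℂ] V :=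
  ∑ m ∈ Finset.range J, (Nat.multichoose s m : ℂ) •
    Ψ.compl₁₂ (LinearMap.mulRight ℂ (X ^ (m + s))) (LinearMap.mulRight ℂ (T (m : ℤ)))

variable (Ψ : ℂ[X] →ₗ[ℂ] LaurentPolynomial ℂ →ₗ[ℂ] V)

theorem expansion_apply (s J : ℕ) (h : ℂ[X]) (f : LaurentPolynomial ℂ) :
    expansion Ψ s J h f = ∑ m ∈ Finset.range J,
      (Nat.multichoose s m : ℂ) • Ψ (h * X ^ (m + s)) (f * T (m : ℤ)) := by
  simp [expansion, LinearMap.sum_apply]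

theorem expansion_zero (J : ℕ) (h : ℂ[X]) (f : LaurentPolynomial ℂ) :
    expansion Ψ 0 (J + 1) h f = Ψ h f := by
  simp [expansion_apply, Finset.sum_range_succ']

/-- The identity `(z⁻¹ - x) κₛ₊₁ = z⁻¹ x κₛ` for `κₛ = xˢ / (1 - z x)ˢ`. -/
theorem expansion_succ (s J : ℕ) (h : ℂ[X]) (f : LaurentPolynomial ℂ) :
    expansion Ψ (s + 1) (J + 1) h (T (-1) * f) =
      expansion Ψ (s + 1) J (X * h) f + expansion Ψ s (J + 1) (X * h) (T (-1) * f) := by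
  have hT (m : ℕ) : T (-1) * f * T ((m + 1 : ℕ) : ℤ) = f * T (m : ℤ) := by
    rw [mul_comm (T (-1)), LaurentPolynomial.mul_T_assoc]
    congr 2
    push_cast
    ring
  have hX (m : ℕ) : X * h * X ^ (m + s) = h * X ^ (m + (s + 1)) := by ring
  have hX' (m : ℕ) : h * X ^ (m + 1 + (s + 1)) = X * h * X ^ (m + (s + 1)) := by ring
  simp only [expansion_apply]
  rw [Finset.sum_range_succ', Finset.sum_range_succ' (n := J) (f := fun m =>
    (Nat.multichoose s m : ℂ) • Ψ (X * h * X ^ (m + s)) (T (-1) * f * T (m : ℤ)))]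
  refine Eq.trans ?_ (add_assoc _ _ _)
  rw [← Finset.sum_add_distrib]
  congr 1
  · refine Finset.sum_congr rfl fun m _ => ?_
    rw [hT, hX', hX, hX', Nat.multichoose_succ_succ, ← add_smul, Nat.cast_add, add_comm]
  · simp only [hX, Nat.multichoose_zero_right]

theorem eventually_expansion_eq
    (hΨ : ∀ f, ∀ᶠ m : ℕ in atTop, ∀ h, Ψ h (f * T (m : ℤ)) = 0) (s : ℕ) (h : ℂ[X])
    (f : LaurentPolynomial ℂ) :
    ∀ᶠ J in atTop, expansion Ψ s (J + 1) h f = expansion Ψ s J h f := by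
  filter_upwards [hΨ f] with J hJ
  rw [expansion_apply, Finset.sum_range_succ, hJ, smul_zero, add_zero, expansion_apply]

variable {Ψ} {N : Submodule ℂ V}

/-- If the expansion of order `s` takes values in `N`, then multiplication by `q(z⁻¹)` in the second
argument of the expansion of order `s + 1` can be traded for multiplication by `q(x)` in the first,
because `z⁻¹ - x` divides `q(z⁻¹) - q(x)` and `z⁻¹ - x` lowers the order. -/
theorem expansion_exchange
    (hΨ : ∀ f, ∀ᶠ m : ℕ in atTop, ∀ h, Ψ h (f * T (m : ℤ)) = 0) {s : ℕ}
    {f : LaurentPolynomial ℂ}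
    (hs : ∀ h g, ∀ᶠ J in atTop, expansion Ψ s J (X * h) (invEval (X * g) * f) ∈ N)
    (q h g : ℂ[X]) :
    ∀ᶠ J in atTop, expansion Ψ (s + 1) J h (invEval (q * g) * f) -
      expansion Ψ (s + 1) J (q * h) (invEval g * f) ∈ N := by
  induction q using Polynomial.induction_on generalizing h with
  | C a =>
    refine Eventually.of_forall fun J => ?_
    simp [C_mul']
  | add p q hp hq =>
    filter_upwards [hp h, hq h] with J h₁ h₂
    have := add_mem h₁ h₂
    simp only [add_mul, map_add, LinearMap.add_apply] at this ⊢
    convert this using 1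
    abel
  | monomial n a ih =>
    have hcomm : invEval (C a * X ^ (n + 1) * g) * f =
        T (-1) * (invEval (C a * X ^ n * g) * f) := by
      simp only [map_mul, map_pow, aeval_X]
      ring
    have hcomm' : invEval (X * (C a * X ^ n * g)) * f =
        T (-1) * (invEval (C a * X ^ n * g) * f) := by
      simp only [map_mul, map_pow, aeval_X]
      ring
    filter_upwards [ih (X * h), (tendsto_add_atTop_nat 1).eventually (hs h (C a * X ^ n * g)),
      eventually_expansion_eq Ψ hΨ (s + 1) h (invEval (C a * X ^ (n + 1) * g) * f)] with J h₁ h₂ h₃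
    rw [← h₃, hcomm, expansion_succ]
    rw [hcomm'] at h₂
    have := add_mem h₁ h₂
    rw [show C a * X ^ n * (X * h) = C a * X ^ (n + 1) * h by ring] at this
    convert this using 1
    abel

/-- If `Ψ` takes values in `N` on the ideal generated by `x r(x)` and on the Laurent polynomials
`g(z⁻¹) f`, then the expansion of `xˢ / (1 - z x)ˢ` takes values in `N` on `g(z⁻¹) (z r(z⁻¹))ˢ f`:
modulo `x r(x)`, each factor `x z r(z⁻¹) / (1 - z x) = x r(z⁻¹) / (z⁻¹ - x)` is the polynomial
`x (r(z⁻¹) - r(x)) / (z⁻¹ - x)` in `x` and `z⁻¹`. -/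
theorem expansion_mem
    (hΨ : ∀ f, ∀ᶠ m : ℕ in atTop, ∀ h, Ψ h (f * T (m : ℤ)) = 0) {r : ℂ[X]}
    {f : LaurentPolynomial ℂ} (hr : ∀ h f, Ψ (X * r * h) f ∈ N)
    (hf : ∀ h g, Ψ h (invEval g * f) ∈ N) (s : ℕ) (h g : ℂ[X]) :
    ∀ᶠ J in atTop, expansion Ψ s J h (invEval g * ((T 1 * invEval r) ^ s * f)) ∈ N := by
  induction s generalizing h g with
  | zero =>
    filter_upwards [eventually_ge_atTop 1] with J hJ
    obtain ⟨J, rfl⟩ := Nat.exists_eq_add_of_le' hJ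
    rw [expansion_zero, pow_zero, one_mul]
    exact hf h g
  | succ s ih =>
    have hT : (T (-1) * T 1 : LaurentPolynomial ℂ) = 1 := by
      rw [← LaurentPolynomial.T_add]; simp
    have hs (h g : ℂ[X]) : ∀ᶠ J in atTop, expansion Ψ s J (X * h)
        (invEval (X * g) * (T 1 * (T 1 * invEval r) ^ s * f)) ∈ N := by
      have : invEval (X * g) * (T 1 * (T 1 * invEval r) ^ s * f) =
          invEval g * ((T 1 * invEval r) ^ s * f) := by
        rw [map_mul, aeval_X]
        linear_combination (invEval g * ((T 1 * invEval r) ^ s * f)) * hT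
      rw [this]
      exact ih (X * h) g
    filter_upwards [expansion_exchange hΨ hs r h g] with J hJ
    have h₁ : expansion Ψ (s + 1) J (r * h)
        (invEval g * (T 1 * (T 1 * invEval r) ^ s * f)) ∈ N := by
      rw [expansion_apply]
      refine sum_mem fun m _ => N.smul_mem _ ?_
      rw [show r * h * X ^ (m + (s + 1)) = X * r * (h * X ^ (m + s)) by ring]
      exact hr _ _
    have h₂ := add_mem hJ h₁
    rw [sub_add_cancel] at h₂
    convert h₂ using 2
    rw [map_mul]
    ring

end Expansion

/-! ### Residues of fields and of normally ordered products -/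

section Residue

variable {M : Type*} [AddCommGroup M] [Module ℂ M]

theorem residue_add (p q : LaurentPolynomial ℂ) (F : VertexOperator ℂ M) :
    residue (p + q) F = residue p F + residue q F := by
  rw [residue, AddMonoidAlgebra.coeff_add]
  exact Finsupp.sum_add_index' (fun _ => zero_smul _ _) fun _ _ _ => add_smul _ _ _

theorem residue_smul (c : ℂ) (p : LaurentPolynomial ℂ) (F : VertexOperator ℂ M) :
    residue (c • p) F = c • residue p F := by
  rw [residue, AddMonoidAlgebra.coeff_smul,
    Finsupp.sum_smul_index' (h := fun i c => c • HVertexOperator.coeff F (-1 - i))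
      fun _ => zero_smul _ _,
    residue, Finsupp.smul_sum]
  simp only [smul_assoc]

theorem residue_T (i : ℤ) (F : VertexOperator ℂ M) :
    residue (T i) F = HVertexOperator.coeff F (-1 - i) := by
  rw [residue, LaurentPolynomial.T, AddMonoidAlgebra.coeff_single,
    Finsupp.sum_single_index (h := fun i c => c • HVertexOperator.coeff F (-1 - i))
      (zero_smul _ _), one_smul]

theorem residue_add_right (p : LaurentPolynomial ℂ) (F G : VertexOperator ℂ M) :
    residue p (F + G) = residue p F + residue p G := by
  simp only [residue, map_add, Pi.add_apply, smul_add, Finsupp.sum_add]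

theorem residue_smul_right (p : LaurentPolynomial ℂ) (c : ℂ) (F : VertexOperator ℂ M) :
    residue p (c • F) = c • residue p F := by
  simp only [residue, map_smul, Pi.smul_apply, Finsupp.smul_sum, smul_comm c]

theorem residue_zero_right (p : LaurentPolynomial ℂ) :
    residue p (0 : VertexOperator ℂ M) = 0 := by
  simpa using residue_smul_right p 0 (0 : VertexOperator ℂ M)

/-- An induction principle for Laurent polynomials over the monomials `z ^ i`. -/
theorem laurent_induction {P : LaurentPolynomial ℂ → Prop} (hadd : ∀ p q, P p → P q → P (p + q))
    (hsmul : ∀ (c : ℂ) p, P p → P (c • p)) (hT : ∀ i : ℤ, P (T i)) (p : LaurentPolynomial ℂ) :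
    P p := by
  induction p using LaurentPolynomial.induction_on' with
  | add p q hp hq => exact hadd p q hp hq
  | C_mul_T n a =>
    rw [← LaurentPolynomial.smul_eq_C_mul]
    exact hsmul _ _ (hT n)

theorem eventually_residue_mul_T (f : LaurentPolynomial ℂ) (F : VertexOperator ℂ M) (v : M) :
    ∀ᶠ m : ℕ in atTop, residue (f * T (m : ℤ)) F v = 0 := by
  induction f using laurent_induction with
  | hadd p q hp hq =>
    filter_upwards [hp, hq] with m h₁ h₂
    rw [add_mul, residue_add, LinearMap.add_apply, h₁, h₂, add_zero]
  | hsmul c p hp =>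
    filter_upwards [hp] with m h
    rw [smul_mul_assoc, residue_smul, LinearMap.smul_apply, h, smul_zero]
  | hT i =>
    obtain ⟨N, hN⟩ := exists_coeff_eq_zero F v
    filter_upwards [eventually_ge_atTop (-i - N).toNat] with m hm
    rw [← LaurentPolynomial.T_add, residue_T]
    exact hN _ (by omega)

/-- The sums are over the nonnegative and the negative powers of `z` in `F`, truncated at
independent large orders. -/
theorem normalOrder_coeff (F G : VertexOperator ℂ M) (n : ℤ) (v : M) :
    ∃ K : ℕ, ∀ J ≥ K, ∀ J' ≥ K, HVertexOperator.coeff (normalOrder F G) n v =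
      ∑ i ∈ Finset.range J, HVertexOperator.coeff F i (HVertexOperator.coeff G (n - i) v) +
      ∑ i ∈ Finset.range J',
        HVertexOperator.coeff G (n + i + 1) (HVertexOperator.coeff F (-i - 1) v) := by
  have hfin := normalTerm_finite F G n v
  refine ⟨hfin.toFinset.sup Int.natAbs + 1, fun J hJ J' hJ' => ?_⟩
  have hbd (i : ℤ) (hi : normalTerm F G n i v ≠ 0) :
      i.natAbs < hfin.toFinset.sup Int.natAbs + 1 :=
    Nat.lt_succ_of_le (Finset.le_sup (f := Int.natAbs) (hfin.mem_toFinset.mpr hi))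
  change ∑ᶠ i : ℤ, normalTerm F G n i v = _
  rw [finsum_eq_sum_of_support_subset (s := (Finset.range J).image (fun i : ℕ => (i : ℤ)) ∪
      (Finset.range J').image (fun i : ℕ => -(i : ℤ) - 1)), Finset.sum_union,
    Finset.sum_image (fun _ _ _ _ => by omega), Finset.sum_image (fun _ _ _ _ => by omega)]
  · congr 1
    refine Finset.sum_congr rfl fun i _ => ?_
    rw [normalTerm, if_neg (show ¬(0 : ℤ) ≤ -i - 1 by omega),
      show n - (-(i : ℤ) - 1) = n + i + 1 by ring]
    rfl
  · rw [Finset.disjoint_left]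
    intro i hi hi'
    simp only [Finset.mem_image] at hi hi'
    obtain ⟨a, -, rfl⟩ := hi
    obtain ⟨b, -, hb⟩ := hi'
    omega
  · intro i hi
    have := hbd i hi
    simp only [Finset.coe_union, Finset.coe_image, Set.mem_union, Set.mem_image, Finset.mem_coe,
      Finset.mem_range]
    rcases le_or_gt 0 i with h | h
    · exact Or.inl ⟨i.natAbs, by omega, by omega⟩
    · exact Or.inr ⟨i.natAbs - 1, by omega, by omega⟩

theorem residue_normalOrder (f : LaurentPolynomial ℂ) (F G : VertexOperator ℂ M) (v : M) :
    ∀ᶠ J in atTop, residue f (normalOrder F G) v =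
      ∑ i ∈ Finset.range J, HVertexOperator.coeff F i (residue (f * T (i : ℤ)) G v) +
      ∑ i ∈ Finset.range J, residue (f * T (-i - 1)) G (HVertexOperator.coeff F (-i - 1) v) := by
  induction f using laurent_induction with
  | hadd p q hp hq =>
    filter_upwards [hp, hq] with J h₁ h₂
    simp only [residue_add, add_mul, LinearMap.add_apply, h₁, h₂, map_add, Finset.sum_add_distrib]
    abel
  | hsmul c p hp =>
    filter_upwards [hp] with J h
    simp only [residue_smul, smul_mul_assoc, LinearMap.smul_apply, h, map_smul, ← Finset.smul_sum,
      smul_add]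
  | hT i =>
    obtain ⟨K, hK⟩ := normalOrder_coeff F G (-1 - i) v
    filter_upwards [eventually_ge_atTop K] with J hJ
    rw [residue_T, hK J hJ J hJ]
    congr 1
    · refine Finset.sum_congr rfl fun j _ => ?_
      rw [← LaurentPolynomial.T_add, residue_T, sub_sub]
    · refine Finset.sum_congr rfl fun j _ => ?_
      rw [← LaurentPolynomial.T_add, residue_T,
        show -1 - (i + (-(j : ℤ) - 1)) = -1 - i + j + 1 by ring]

/-! ### Divided derivatives -/

theorem coeff_iterate_derivField (t : ℕ) (F : VertexOperator ℂ M) (n : ℤ) :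
    HVertexOperator.coeff (derivField^[t] F) n =
      (ascPochhammer ℂ t).eval ((n : ℂ) + 1) • HVertexOperator.coeff F (n + t) := by
  induction t generalizing F with
  | zero => simp
  | succ t ih =>
    have hF : HVertexOperator.coeff (derivField F) (n + t) =
      ((n + t + 1 : ℤ) : ℂ) • HVertexOperator.coeff F (n + t + 1) := rfl
    rw [Function.iterate_succ_apply, ih, hF, ascPochhammer_succ_eval, smul_smul]
    congr 1
    · push_cast
      ring
    · rw [Nat.cast_succ, add_assoc]

/-- The divided derivative `∂ᵗ F(z) / t!`. -/
noncomputable def dividedDeriv (t : ℕ) (F : VertexOperator ℂ M) : VertexOperator ℂ M :=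
  (t.factorial : ℂ)⁻¹ • (derivField^[t] F)

theorem coeff_dividedDeriv_natCast (t : ℕ) (F : VertexOperator ℂ M) (i : ℕ) :
    HVertexOperator.coeff (dividedDeriv t F) i =
      (Nat.multichoose (t + 1) i : ℂ) • HVertexOperator.coeff F (i + t) := by
  rw [dividedDeriv, map_smul, Pi.smul_apply, coeff_iterate_derivField, smul_smul]
  congr 1
  have h : (ascPochhammer ℂ t).eval (((i : ℤ) : ℂ) + 1) = t.factorial * (i + t).choose t := by
    rw [← Nat.cast_mul, ← Nat.ascFactorial_eq_factorial_mul_choose,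
      ← ascPochhammer_nat_eq_ascFactorial, ascPochhammer_eval_cast]
    push_cast
    rfl
  rw [h, inv_mul_cancel_left₀ (by exact_mod_cast t.factorial_ne_zero), Nat.multichoose_eq,
    show t + 1 + i - 1 = i + t by omega, Nat.choose_symm_add]

theorem coeff_dividedDeriv_neg (t : ℕ) (F : VertexOperator ℂ M) (i : ℕ) :
    HVertexOperator.coeff (dividedDeriv t F) (-i - 1) =
      ((-1) ^ t * (i.choose t : ℂ)) • HVertexOperator.coeff F (-i - 1 + t) := by
  rw [dividedDeriv, map_smul, Pi.smul_apply, coeff_iterate_derivField, smul_smul]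
  congr 1
  have h : (ascPochhammer ℂ t).eval (((-i - 1 : ℤ) : ℂ) + 1) =
      t.factorial * ((-1) ^ t * i.choose t) := by
    rw [show ((-i - 1 : ℤ) : ℂ) + 1 = -(i : ℂ) by push_cast; ring,
      ascPochhammer_eval_neg_eq_descPochhammer, descPochhammer_eval_eq_descFactorial,
      Nat.descFactorial_eq_factorial_mul_choose]
    push_cast
    ring
  rw [h, inv_mul_cancel_left₀ (by exact_mod_cast t.factorial_ne_zero)]

end Residue

/-! ### The action of the affine algebra -/

section Affine

variable {𝔤 : Type*} [LieRing 𝔤] [LieAlgebra ℂ 𝔤] (B : InvariantForm 𝔤)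

theorem loopElt_add (f g : LaurentPolynomial ℂ) (x : 𝔤) :
    loopElt B (f + g) x = loopElt B f x + loopElt B g x := by
  rw [loopElt, TensorProduct.add_tmul, loopElt, loopElt, ← LieAlgebra.of_add, Prod.mk_add_mk,
    add_zero]

theorem loopElt_smul (c : ℂ) (f : LaurentPolynomial ℂ) (x : 𝔤) :
    loopElt B (c • f) x = c • loopElt B f x := by
  rw [loopElt, ← TensorProduct.smul_tmul', loopElt, ← LieAlgebra.of_smul, Prod.smul_mk, smul_zero]

theorem loopElt_invEval_X_pow (n : ℕ) (x : 𝔤) :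
    loopElt B (invEval (X ^ n)) x = tensorT B x (-n) := by
  rw [map_pow, aeval_X, LaurentPolynomial.T_pow, tensorT, mul_neg_one]

variable {n : ℕ} (u : Fin (n + 1) → OnePoint ℂ)

/-- The polynomial `∏ (x - uⱼ⁻¹)` over the points other than the first. -/
noncomputable def tailPoly : ℂ[X] := ∏ j : Fin n, (X - C (invPoint (u j.succ)))

theorem invEval_tailPoly : invEval (tailPoly u) =
    ∏ j : Fin n, (T (-1) - LaurentPolynomial.C (invPoint (u j.succ))) := by
  rw [tailPoly, map_prod]
  refine Finset.prod_congr rfl fun j _ => ?_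
  rw [map_sub, aeval_X, aeval_C]
  rfl

variable {u}

theorem prod_sub_invPoint (hu : u 0 = OnePoint.infty) :
    ∏ j, (T (-1) - LaurentPolynomial.C (invPoint (u j))) = invEval (X * tailPoly u) := by
  rw [Fin.prod_univ_succ, hu, map_mul, invEval_tailPoly, aeval_X]
  simp [invPoint]

theorem loopElt_mem_coinvariantSubalgebra (hu : u 0 = OnePoint.infty) (h : ℂ[X]) (x : 𝔤) :
    loopElt B (invEval (X * tailPoly u * h)) x ∈ coinvariantSubalgebra B u := by
  refine Submodule.subset_span ⟨h, x, ?_⟩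
  rw [prod_sub_invPoint hu, ← map_mul]

/-- `𝔤 ⊗ ℂ[t⁻¹]` normalizes the subalgebra, which is an ideal of it. -/
theorem lie_mem_coinvariantSubalgebra (hu : u 0 = OnePoint.infty) (h : ℂ[X]) (x : 𝔤)
    {Z : AffineLie B} (hZ : Z ∈ coinvariantSubalgebra B u) :
    ⁅loopElt B (invEval h) x, Z⁆ ∈ coinvariantSubalgebra B u := by
  change Z ∈ Submodule.span ℂ _ at hZ
  induction hZ using Submodule.span_induction with
  | mem Z hZ =>
    obtain ⟨q, y, rfl⟩ := hZ
    rw [prod_sub_invPoint hu, ← map_mul, lie_loopElt, residuePairing_aeval, neg_zero, zero_smul,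
      add_zero, ← map_mul, mul_left_comm]
    exact loopElt_mem_coinvariantSubalgebra B hu _ _
  | zero => rw [lie_zero]; exact zero_mem _
  | add Y Z _ _ hY hZ => rw [lie_add]; exact add_mem hY hZ
  | smul c Z _ hZ => rw [lie_smul]; exact Submodule.smul_mem _ c hZ

variable {M : Type*} [AddCommGroup M] [Module ℂ M] [LieRingModule (AffineLie B) M]
  [LieModule ℂ (AffineLie B) M]

theorem lie_mem_actionSpan (hu : u 0 = OnePoint.infty) (h : ℂ[X]) (x : 𝔤) {w : M}
    (hw : w ∈ actionSpan B (coinvariantSubalgebra B u) M) :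
    ⁅loopElt B (invEval h) x, w⁆ ∈ actionSpan B (coinvariantSubalgebra B u) M := by
  induction hw using Submodule.span_induction with
  | mem w hw =>
    obtain ⟨Z, hZ, v, rfl⟩ := hw
    rw [leibniz_lie]
    exact add_mem
      (Submodule.subset_span ⟨_, lie_mem_coinvariantSubalgebra B hu h x hZ, v, rfl⟩)
      (Submodule.subset_span ⟨Z, hZ, _, rfl⟩)
  | zero => rw [lie_zero]; exact zero_mem _
  | add v w _ _ hv hw => rw [lie_add]; exact add_mem hv hw
  | smul c w _ hw => rw [lie_smul]; exact Submodule.smul_mem _ c hw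

/-! ### The subspace computed from the fields of words -/

/-- The bilinear map `(h, f) ↦ (a ⊗ h(t⁻¹)) Res (f(z) G(z)) v`. -/
noncomputable def actionPairing (a : 𝔤) (G : VertexOperator ℂ M) (v : M) :
    ℂ[X] →ₗ[ℂ] LaurentPolynomial ℂ →ₗ[ℂ] M :=
  LinearMap.mk₂ ℂ (fun h f => ⁅loopElt B (invEval h) a, residue f G v⁆)
    (fun h h' f => by rw [map_add, loopElt_add, add_lie])
    (fun c h f => by rw [map_smul, loopElt_smul, smul_lie])
    (fun h f f' => by rw [residue_add, LinearMap.add_apply, lie_add])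
    (fun c h f => by rw [residue_smul, LinearMap.smul_apply, lie_smul])

theorem actionPairing_apply (a : 𝔤) (G : VertexOperator ℂ M) (v : M) (h : ℂ[X])
    (f : LaurentPolynomial ℂ) :
    actionPairing B a G v h f = ⁅loopElt B (invEval h) a, residue f G v⁆ := rfl

variable {B}

/-- The modes `a ⊗ t⁻ᵐ`, `m > t`, of `∂ᵗ a(z) / t!` come with the coefficients of the expansion of
`xᵗ⁺¹ / (1 - z x)ᵗ⁺¹`, where `xᵐ` stands for `a ⊗ t⁻ᵐ`. -/
theorem sum_creation_modes (hM : IsSmooth B M) (a : 𝔤) (t J : ℕ) (f : LaurentPolynomial ℂ)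
    (G : VertexOperator ℂ M) (v : M) :
    ∑ i ∈ Finset.range J, HVertexOperator.coeff (dividedDeriv t (current B hM a)) i
      (residue (f * T (i : ℤ)) G v) = expansion (actionPairing B a G v) (t + 1) J 1 f := by
  rw [expansion_apply]
  refine Finset.sum_congr rfl fun i _ => ?_
  rw [coeff_dividedDeriv_natCast, one_mul, actionPairing_apply, loopElt_invEval_X_pow,
    LinearMap.smul_apply]
  congr 1
  change ⁅tensorT B a (-(i + t) - 1), residue (f * T (i : ℤ)) G v⁆ = _
  rw [show -((i : ℤ) + t) - 1 = -((i + (t + 1) : ℕ) : ℤ) by push_cast; ring]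

/-- The inductive step in the length of the word. The creation modes of the left factor contribute
the expansion treated in `expansion_mem`; each annihilation mode acts on `v` first, and
contributes a residue of `G` of the same kind. -/
theorem residue_normalOrder_mem (hM : IsSmooth B M) (hu : u 0 = OnePoint.infty) (a : 𝔤) (t d : ℕ)
    {G : VertexOperator ℂ M}
    (hG : ∀ g v, residue (invEval g * (T (-2) * (T 1 * invEval (tailPoly u)) ^ d)) G v ∈
      actionSpan B (coinvariantSubalgebra B u) M) (g : ℂ[X]) (v : M) :
    residue (invEval g * (T (-2) * (T 1 * invEval (tailPoly u)) ^ (t + 1 + d)))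
      (normalOrder (dividedDeriv t (current B hM a)) G) v ∈
        actionSpan B (coinvariantSubalgebra B u) M := by
  have hf : invEval g * (T (-2) * (T 1 * invEval (tailPoly u)) ^ (t + 1 + d)) =
      invEval g * ((T 1 * invEval (tailPoly u)) ^ (t + 1) *
        (T (-2) * (T 1 * invEval (tailPoly u)) ^ d)) := by
    rw [pow_add]
    ring
  have hexp := expansion_mem (Ψ := actionPairing B a G v)
    (N := actionSpan B (coinvariantSubalgebra B u) M) (r := tailPoly u)
    (f := T (-2) * (T 1 * invEval (tailPoly u)) ^ d)
    (fun f => (eventually_residue_mul_T f G v).mono fun m hm h => by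
      rw [actionPairing_apply, hm, lie_zero])
    (fun h f => Submodule.subset_span
      ⟨_, loopElt_mem_coinvariantSubalgebra B hu h a, _, rfl⟩)
    (fun h g => lie_mem_actionSpan B hu h a (hG g v)) (t + 1) 1 g
  obtain ⟨J, hJ, hJ'⟩ := ((residue_normalOrder (invEval g * (T (-2) *
    (T 1 * invEval (tailPoly u)) ^ (t + 1 + d))) (dividedDeriv t (current B hM a)) G v).and
      hexp).exists
  rw [hJ, sum_creation_modes, hf]
  refine add_mem hJ' (sum_mem fun i _ => ?_)
  rw [coeff_dividedDeriv_neg, LinearMap.smul_apply, map_smul]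
  rcases lt_or_ge i t with hi | hi
  · rw [Nat.choose_eq_zero_of_lt hi, Nat.cast_zero, mul_zero, zero_smul]
    exact zero_mem _
  · refine Submodule.smul_mem _ _ ?_
    convert hG (g * X ^ (i - t) * tailPoly u ^ (t + 1)) (HVertexOperator.coeff
      (current B hM a) (-i - 1 + t) v) using 3
    have hT : (T 1 ^ (t + 1) * T (-i - 1) : LaurentPolynomial ℂ) = T (-1) ^ (i - t) := by
      rw [LaurentPolynomial.T_pow, LaurentPolynomial.T_pow, ← LaurentPolynomial.T_add]
      congr 1
      push_cast [hi]
      ring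
    simp only [map_mul, map_pow, aeval_X, mul_pow]
    linear_combination (invEval g * (invEval (tailPoly u)) ^ (t + 1) *
      (T (-2) * (T 1 ^ d * invEval (tailPoly u) ^ d))) * hT

theorem residue_idField_eq_zero (g : ℂ[X]) :
    residue (invEval g * T (-2)) (idField : VertexOperator ℂ M) = 0 := by
  induction g using Polynomial.induction_on' with
  | add p q hp hq => rw [map_add, add_mul, residue_add, hp, hq, add_zero]
  | monomial n c =>
    rw [aeval_monomial, ← Algebra.smul_def, smul_mul_assoc, residue_smul, LaurentPolynomial.T_pow,
      ← LaurentPolynomial.T_add, residue_T]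
    refine smul_eq_zero_of_right _ ?_
    change (if _ then _ else _) = _
    rw [if_neg (by omega)]

theorem residue_wordField_mem (hM : IsSmooth B M) (hu : u 0 = OnePoint.infty)
    (W : List (𝔤 × ℕ+)) (g : ℂ[X]) (v : M) :
    residue (invEval g * (T (-2) * (T 1 * invEval (tailPoly u)) ^ wordDegree W))
      (wordField B hM W) v ∈ actionSpan B (coinvariantSubalgebra B u) M := by
  induction W generalizing g v with
  | nil =>
    rw [show wordDegree ([] : List (𝔤 × ℕ+)) = 0 from rfl, pow_zero, mul_one,
      show wordField B hM [] = idField from rfl, residue_idField_eq_zero]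
    exact zero_mem _
  | cons p W ih =>
    have h := residue_normalOrder_mem hM hu p.1 ((p.2 : ℕ) - 1) (wordDegree W) ih g v
    rwa [Nat.sub_add_cancel p.2.pos] at h

theorem normalOrder_idField (F : VertexOperator ℂ M) : normalOrder F idField = F := by
  refine HVertexOperator.coeff_inj (funext fun n => LinearMap.ext fun v => ?_)
  change ∑ᶠ i : ℤ, normalTerm F idField n i v = _
  have hid (m : ℤ) : HVertexOperator.coeff (idField : VertexOperator ℂ M) m =
      if m = 0 then 1 else 0 := rfl
  rw [finsum_eq_single _ n]
  · simp only [normalTerm, hid, sub_self, if_true]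
    split_ifs <;> rfl
  · intro i hi
    simp only [normalTerm, hid, if_neg (show ¬n - i = 0 by omega)]
    split_ifs <;> simp

theorem residue_current (hM : IsSmooth B M) (a : 𝔤) (f : LaurentPolynomial ℂ) (v : M) :
    residue f (current B hM a) v = ⁅loopElt B f a, v⁆ := by
  induction f using laurent_induction with
  | hadd p q hp hq => rw [residue_add, LinearMap.add_apply, hp, hq, loopElt_add, add_lie]
  | hsmul c p hp => rw [residue_smul, LinearMap.smul_apply, hp, loopElt_smul, smul_lie]
  | hT i =>
    rw [residue_T]
    change ⁅tensorT B a (-(-1 - i) - 1), v⁆ = _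
    rw [show -(-1 - i) - 1 = i by ring, tensorT]

theorem wordField_singleton (hM : IsSmooth B M) (a : 𝔤) :
    wordField B hM [(a, 1)] = current B hM a := by
  change normalOrder (((0 : ℕ).factorial : ℂ)⁻¹ • current B hM a) idField = _
  rw [normalOrder_idField, Nat.factorial_zero, Nat.cast_one, inv_one, one_smul]

theorem ggOperator_eq_residue (m d : ℕ) (F : VertexOperator ℂ M) :
    ggOperator u (m + 1) d F =
      residue (invEval (X ^ m) * (T (-2) * (T 1 * invEval (tailPoly u)) ^ d)) F := by
  rw [ggOperator, Finset.prod_pow, ← invEval_tailPoly, mul_pow, map_pow, aeval_X,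
    LaurentPolynomial.T_pow, LaurentPolynomial.T_pow, ← mul_assoc, ← mul_assoc,
    ← LaurentPolynomial.T_add, ← LaurentPolynomial.T_add]
  congr 3
  ring

/-- The equality holds for every smooth module over the affine algebra of any invariant form. -/
theorem gaberdielGoddard_eq_actionSpan (hM : IsSmooth B M) (k : ℕ) (hu : u 0 = OnePoint.infty) :
    gaberdielGoddard B k hM u = actionSpan B (coinvariantSubalgebra B u) M := by
  refine le_antisymm (Submodule.span_le.mpr ?_) (Submodule.span_le.mpr ?_)
  · rintro _ ⟨⟨d, F⟩, ⟨A, hA⟩, N, hN, v, rfl⟩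
    obtain ⟨m, rfl⟩ : ∃ m : ℕ, N = m + 1 := ⟨(N - 1).toNat, by omega⟩
    rw [ggOperator_eq_residue]
    change residue _ (A, F).2 v ∈ actionSpan B (coinvariantSubalgebra B u) M
    change (A, F) ∈ fieldGraph B k hM d at hA
    generalize (A, F) = P at hA ⊢
    induction hA using Submodule.span_induction with
    | mem P hP =>
      obtain ⟨W, rfl, rfl⟩ := hP
      exact residue_wordField_mem hM hu W _ v
    | zero =>
      rw [Prod.snd_zero, residue_zero_right]
      exact zero_mem _
    | add P Q _ _ hP hQ =>
      rw [Prod.snd_add, residue_add_right]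
      exact add_mem hP hQ
    | smul c P _ hP =>
      rw [Prod.smul_snd, residue_smul_right]
      exact Submodule.smul_mem _ c hP
  · rintro _ ⟨Z, hZ, v, rfl⟩
    change Z ∈ Submodule.span ℂ _ at hZ
    change ⁅Z, v⁆ ∈ gaberdielGoddard B k hM u
    induction hZ using Submodule.span_induction with
    | zero => rw [zero_lie]; exact zero_mem _
    | add Y Z _ _ hY hZ => rw [add_lie]; exact add_mem hY hZ
    | smul c Z _ hZ => rw [smul_lie]; exact Submodule.smul_mem _ c hZ
    | mem Z hZ =>
      obtain ⟨q, x, rfl⟩ := hZ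
      rw [prod_sub_invPoint hu]
      induction q using Polynomial.induction_on' with
      | add p q hp hq => rw [map_add, mul_add, loopElt_add, add_lie]; exact add_mem hp hq
      | monomial m c =>
        rw [← C_mul_X_pow_eq_monomial, C_mul', map_smul, mul_smul_comm, loopElt_smul, smul_lie]
        refine Submodule.smul_mem _ c (Submodule.subset_span ⟨(1, current B hM x),
          ⟨wordState B k [(x, 1)], Submodule.subset_span ⟨[(x, 1)], rfl, ?_⟩⟩, m + 1, by omega, v,
          ?_⟩)
        · rw [wordField_singleton]
        · rw [ggOperator_eq_residue, residue_current]
          congr 2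
          have hT : (T (-2) * T 1 : LaurentPolynomial ℂ) = T (-1) := by
            rw [← LaurentPolynomial.T_add]
            rfl
          rw [map_mul, aeval_X, pow_one]
          linear_combination (-(invEval (tailPoly u) * invEval (X ^ m))) * hT

end Affine

/-! ### Vertex algebra structures with the given currents -/

section VertexAlgebra

open scoped VertexOperator

variable {𝔤 : Type*} [LieRing 𝔤] [LieAlgebra ℂ 𝔤] {B : InvariantForm 𝔤} {k : ℕ}
  {M : Type*} [AddCommGroup M] [Module ℂ M] [LieRingModule (AffineLie B) M]
  [LieModule ℂ (AffineLie B) M]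

theorem ringChoose_neg_succ (t j : ℕ) :
    Ring.choose (-((t : ℤ) + 1)) j = (-1) ^ j * (Nat.multichoose (t + 1) j : ℤ) := by
  rw [Ring.choose_neg, show (t : ℤ) + 1 + j - 1 = ((t + 1 + j - 1 : ℕ) : ℤ) by omega,
    Ring.choose_natCast, ← Nat.multichoose_eq, Units.smul_def, Int.coe_negOnePow_natCast,
    smul_eq_mul]

/-- The coefficients of `:∂ᵗ a(z) G(z): / t!`, as the right-hand side of the Borcherds identity for
the `(-t - 1)`-st product of `a(z)` with `G(z)`. -/
theorem coeff_normalOrder_current (hM : IsSmooth B M) (a : 𝔤) (t : ℕ) (G : VertexOperator ℂ M)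
    (n : ℤ) (v : M) :
    ∃ K : ℕ, ∀ J ≥ K, HVertexOperator.coeff
      (normalOrder (dividedDeriv t (current B hM a)) G) n v =
        ∑ j ∈ Finset.range J, (Nat.multichoose (t + 1) j : ℂ) •
          (⁅tensorT B a (-(t + 1) - j), HVertexOperator.coeff G (n - j) v⁆ +
            (-1 : ℂ) ^ t • HVertexOperator.coeff G (n + t + j + 1) ⁅tensorT B a j, v⁆) := by
  obtain ⟨K, hK⟩ := normalOrder_coeff (dividedDeriv t (current B hM a)) G n v
  refine ⟨K, fun J hJ => ?_⟩
  have h0 : ∑ i ∈ Finset.range t, HVertexOperator.coeff G (n + i + 1) (HVertexOperator.coeff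
      (dividedDeriv t (current B hM a)) (-i - 1) v) = 0 := Finset.sum_eq_zero fun i hi => by
    rw [coeff_dividedDeriv_neg, Nat.choose_eq_zero_of_lt (Finset.mem_range.mp hi)]
    simp only [Nat.cast_zero, mul_zero, zero_smul, LinearMap.zero_apply, map_zero]
  rw [hK J hJ (t + J) (by omega), Finset.sum_range_add, h0, zero_add, ← Finset.sum_add_distrib]
  refine Finset.sum_congr rfl fun j _ => ?_
  rw [coeff_dividedDeriv_natCast, coeff_dividedDeriv_neg, LinearMap.smul_apply,
    LinearMap.smul_apply, map_smul, smul_add, smul_smul]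
  congr 1
  · change _ • ⁅tensorT B a (-(j + t) - 1), _⁆ = _
    rw [show -((j : ℤ) + t) - 1 = -(t + 1) - j by ring]
  · rw [Nat.multichoose_eq, show t + 1 + j - 1 = t + j by omega, ← Nat.choose_symm_add, mul_comm]
    change _ • HVertexOperator.coeff G _ ⁅tensorT B a (-(-((t + j : ℕ) : ℤ) - 1 + t) - 1), v⁆ = _
    rw [show -(-((t + j : ℕ) : ℤ) - 1 + t) - 1 = j by push_cast; ring,
      show n + ((t + j : ℕ) : ℤ) + 1 = n + t + j + 1 by push_cast; ring]

variable {𝒱 : VertexAlgebraStructure (VacuumModule B k) (vacuum B k)}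

/-- By the Borcherds identity with `p = 0` and `r = -t - 1`, the field of `a ⊗ t⁻ᵗ⁻¹ A` is the
normally ordered product of `∂ᵗ a(z) / t!` with the field of `A`. -/
theorem field_lie_tensorT (hM : IsSmooth B M) (𝒴 : VertexModuleStructure 𝒱 M)
    (hV : HasCurrents B k (VacuumModule B k) 𝒱.Y) (hY : HasCurrents B k M 𝒴.Y) (a : 𝔤) (t : ℕ)
    (A : VacuumModule B k) :
    𝒴.Y ⁅tensorT B a (-(t + 1)), A⁆ =
      normalOrder (dividedDeriv t (current B hM a)) (𝒴.Y A) := by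
  refine HVertexOperator.coeff_inj (funext fun n => LinearMap.ext fun v => ?_)
  have hb := 𝒴.borcherds ⁅tensorT B a (-1), vacuum B k⁆ A v 0 (-n - 1) (-(t + 1))
  have hchoose (j : ℕ) (hj : j ≠ 0) (w : M) : ((Ring.choose (0 : ℤ) j : ℤ) : ℂ) • w = 0 := by
    rw [Ring.choose_zero_pos ℤ (Nat.pos_of_ne_zero hj), Int.cast_zero, zero_smul]
  rw [finsum_eq_single _ 0 fun j hj => hchoose j hj _, Ring.choose_zero_right, Int.cast_one,
    one_smul, Nat.cast_zero, add_zero, sub_zero, zero_add,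
    hV, VertexOperator.ncoeff_apply, show -(-n - 1) - 1 = n by ring] at hb
  rw [hb]
  have hterm (j : ℕ) : ((-1 : ℂ) ^ j * ((Ring.choose (-((t : ℤ) + 1)) j : ℤ) : ℂ)) •
      (((𝒴.Y ⁅tensorT B a (-1), vacuum B k⁆)[[0 + -(t + 1) - j]]) (((𝒴.Y A)[[-n - 1 + j]]) v) -
        (-1 : ℂ) ^ (-((t : ℤ) + 1)) • ((𝒴.Y A)[[-n - 1 + -(t + 1) - j]])
          (((𝒴.Y ⁅tensorT B a (-1), vacuum B k⁆)[[0 + j]]) v)) =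
      (Nat.multichoose (t + 1) j : ℂ) •
          (⁅tensorT B a (-(t + 1) - j), HVertexOperator.coeff (𝒴.Y A) (n - j) v⁆ +
            (-1 : ℂ) ^ t •
              HVertexOperator.coeff (𝒴.Y A) (n + t + j + 1) ⁅tensorT B a j, v⁆) := by
    have hsign : -(-1 : ℂ) ^ (-((t : ℤ) + 1)) = (-1) ^ t := by
      rw [zpow_neg, ← inv_zpow, inv_neg_one, ← Nat.cast_succ, zpow_natCast, pow_succ]
      ring
    rw [hY, hY, VertexOperator.ncoeff_apply, VertexOperator.ncoeff_apply, zero_add, zero_add,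
      show -(-n - 1 + (j : ℤ)) - 1 = n - j by ring,
      show -(-n - 1 + -((t : ℤ) + 1) - j) - 1 = n + t + j + 1 by ring, sub_eq_add_neg, ← neg_smul,
      hsign, ringChoose_neg_succ]
    congr 1
    push_cast
    rw [← mul_assoc, ← mul_pow]
    simp
  rw [finsum_congr hterm]
  obtain ⟨K, hK⟩ := coeff_normalOrder_current hM a t (𝒴.Y A) n v
  obtain ⟨N, hN⟩ := exists_coeff_eq_zero (𝒴.Y A) v
  obtain ⟨N', hN'⟩ := hM v
  rw [hK (K + (n - N).toNat + N'.toNat + 1) (by omega)]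
  refine finsum_eq_sum_of_support_subset _ fun j hj => ?_
  by_contra hcon
  simp only [Finset.coe_range, Set.mem_Iio, not_lt] at hcon
  refine hj ?_
  simp only [hN (n - j) (by omega), hN' j (by omega) a, lie_zero, map_zero, smul_zero, add_zero]

theorem field_wordState (hM : IsSmooth B M) (𝒴 : VertexModuleStructure 𝒱 M)
    (hV : HasCurrents B k (VacuumModule B k) 𝒱.Y) (hY : HasCurrents B k M 𝒴.Y)
    (W : List (𝔤 × ℕ+)) : 𝒴.Y (wordState B k W) = wordField B hM W := by
  induction W with
  | nil => exact 𝒴.Y_vac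
  | cons p W ih =>
    have h := field_lie_tensorT hM 𝒴 hV hY p.1 ((p.2 : ℕ) - 1) (wordState B k W)
    have hp : (((p.2 : ℕ) - 1 : ℕ) : ℤ) + 1 = (p.2 : ℕ) := by
      have := p.2.pos
      omega
    rw [hp, ih] at h
    exact h

theorem homogeneousFields_eq (hM : IsSmooth B M) (𝒴 : VertexModuleStructure 𝒱 M)
    (hV : HasCurrents B k (VacuumModule B k) 𝒱.Y) (hY : HasCurrents B k M 𝒴.Y) :
    homogeneousFields B k 𝒴.Y = affineFields B k hM := by
  ext ⟨d, F⟩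
  constructor
  · rintro ⟨A, hA, rfl : F = 𝒴.Y A⟩
    refine ⟨A, ?_⟩
    change A ∈ vacuumDegree B k d at hA
    change (A, 𝒴.Y A) ∈ fieldGraph B k hM d
    induction hA using Submodule.span_induction with
    | mem A hA =>
      obtain ⟨W, hW, rfl⟩ := hA
      exact Submodule.subset_span ⟨W, hW, by rw [field_wordState hM 𝒴 hV hY]⟩
    | zero => rw [map_zero]; exact zero_mem _
    | add A A' _ _ h h' => rw [map_add]; exact add_mem h h'
    | smul c A _ h => rw [map_smul]; exact Submodule.smul_mem _ c h
  · rintro ⟨A, hA⟩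
    change (A, F) ∈ fieldGraph B k hM d at hA
    have h : ∀ P ∈ fieldGraph B k hM d, P.1 ∈ vacuumDegree B k d ∧ P.2 = 𝒴.Y P.1 := by
      intro P hP
      induction hP using Submodule.span_induction with
      | mem P hP =>
        obtain ⟨W, hW, rfl⟩ := hP
        exact ⟨Submodule.subset_span ⟨W, hW, rfl⟩, (field_wordState hM 𝒴 hV hY W).symm⟩
      | zero => exact ⟨zero_mem _, (map_zero _).symm⟩
      | add P Q _ _ hP hQ =>
        exact ⟨add_mem hP.1 hQ.1, by rw [Prod.snd_add, Prod.fst_add, map_add, hP.2, hQ.2]⟩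
      | smul c P _ hP =>
        exact ⟨Submodule.smul_mem _ c hP.1, by rw [Prod.smul_snd, Prod.smul_fst, map_smul, hP.2]⟩
    exact ⟨A, h _ hA⟩

end VertexAlgebra

end GaberdielGoddard

open GaberdielGoddard in
/-- Let `H` be an integrable irreducible highest weight module of level `k` over the affine
Kac–Moody algebra of a simple Lie algebra `𝔤`, and let `u 0 = ∞`, `u j ∈ ℂℙ¹ ∖ {0}`. Then `O_u(H)`
is the space `(𝔤 ⊗ ∏ⱼ (t⁻¹ - uⱼ⁻¹) ℂ[t⁻¹]) H`, so that `A_u(H)` is the space of coinvariants. The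
last clause is the equality for an arbitrary `V_k(𝔤)`-module structure on `H` whose currents are
given by the action of the affine algebra. -/
theorem theorem1 {𝔤 : Type*} [LieRing 𝔤] [LieAlgebra ℂ 𝔤] [FiniteDimensional ℂ 𝔤]
    [LieAlgebra.IsSimple ℂ 𝔤] (𝔥 : LieSubalgebra ℂ 𝔤) [𝔥.IsCartanSubalgebra]
    (b : (LieAlgebra.IsKilling.rootSystem 𝔥).Base) (θ : 𝔥.root) (hθ : IsHighestRoot b θ)
    (k : ℕ) (H : Type*) [AddCommGroup H] [Module ℂ H]
    [LieRingModule (AffineLie (normalizedForm θ)) H]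
    [LieModule ℂ (AffineLie (normalizedForm θ)) H]
    (hH : IsIntegrableHighestWeight b θ k H)
    (n : ℕ) (u : Fin (n + 1) → OnePoint ℂ) (hu_infty : u 0 = OnePoint.infty)
    (hu : ∀ j, u j ≠ ((0 : ℂ) : OnePoint ℂ)) :
    gaberdielGoddard (normalizedForm θ) k hH.isSmooth u =
        actionSpan (normalizedForm θ) (coinvariantSubalgebra (normalizedForm θ) u) H ∧
    (∃ e : GGSpace (normalizedForm θ) k hH.isSmooth u ≃ₗ[ℂ]
        Coinvariants (normalizedForm θ) (coinvariantSubalgebra (normalizedForm θ) u) H,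
      ∀ v : H, e (Submodule.Quotient.mk v) = Submodule.Quotient.mk v) ∧
    ∀ (𝒱 : VertexAlgebraStructure (VacuumModule (normalizedForm θ) k)
        (vacuum (normalizedForm θ) k)) (𝒴 : VertexModuleStructure 𝒱 H),
      HasCurrents (normalizedForm θ) k (VacuumModule (normalizedForm θ) k) 𝒱.Y →
      HasCurrents (normalizedForm θ) k H 𝒴.Y →
      ggSubspace u (homogeneousFields (normalizedForm θ) k 𝒴.Y) =
        actionSpan (normalizedForm θ) (coinvariantSubalgebra (normalizedForm θ) u) H := by
  have h := gaberdielGoddard_eq_actionSpan hH.isSmooth k hu_infty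
  refine ⟨h, ⟨Submodule.quotEquivOfEq _ _ h, fun v => rfl⟩, fun 𝒱 𝒴 hV hY => ?_⟩
  rw [homogeneousFields_eq hH.isSmooth 𝒴 hV hY]
  exact h
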